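/- For a positive integer $N$ let $\zeta_N=\exp(2\pi i/N)$, and put $\alpha=\zeta_3$, $\beta=\zeta_5$, $\gamma=\zeta_7$. Let $f(x,y)=1+x+y+x^2y^3+x^3y^2+x^3y^3$. Define $$S_0=\{(1,-1),(-1,1)\},$$ $$S_1=\{(\alpha,\alpha),(\alpha^2,\alpha),(\alpha,\alpha^2),(\alpha^2,\alpha^2),(\alpha,-\alpha),(-\alpha,\alpha),(\alpha^2,-\alpha^2),(-\alpha^2,\alpha^2)\},$$ $$S_2=\{(\beta^k\alpha,\beta^k\alpha^2):1\le k\le 4\}\cup\{(\beta^k\alpha^2,\beta^k\alpha):1\le k\le 4\},$$ $$S_3=\{(\gamma,-\gamma^4),(\gamma^2,-\gamma),(\gamma^3,-\gamma^5),(\gamma^4,-\gamma^2),(\gamma^5,-\gamma^6),(\gamma^6,-\gamma^3),$$ $$(-\gamma,\gamma^2),(-\gamma^2,\gamma^4),(-\gamma^3,\gamma^6),(-\gamma^4,\gamma),(-\gamma^5,\gamma^3),(-\gamma^6,\gamma^5)\},$$ and $S=S_0\cup S_1\cup S_2\cup S_3$. **Theorem.** The set of all pairs $(x,y)\in\mathbb{C}^2$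 such that $f(x,y)=0$ and $x^N=y^N=1$ for some positive integer $N$ is equal to $S$, and $|S|=30$. Moreover, this set is equal to $\{(\zeta_{210}^a,\zeta_{210}^b):(a,b)\in P\}$, where $P$ is the set of $30$ pairs consisting of $(70,70)$, $(140,140)$, the fourteen pairs $$(0,105),(14,154),(15,30),(28,98),(35,140),(45,90),(56,196),$$ $$(60,135),(70,140),(70,175),(75,150),(112,182),(120,165),(180,195),$$ and the fourteen pairs $(b,a)$ obtained from these by exchanging the two entries. -/

import Mathlib

namespace Sharygin

/-- The standard primitive `N`-th root of unity `exp(2πi/N)` (used for `N ≥ 1`). -/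
noncomputable def zeta (N : ℕ) : ℂ := Complex.exp (2 * Real.pi * Complex.I / N)

/-- The polynomial `f(x, y) = 1 + x + y + x²y³ + x³y² + x³y³`. -/
def f (x y : ℂ) : ℂ := 1 + x + y + x ^ 2 * y ^ 3 + x ^ 3 * y ^ 2 + x ^ 3 * y ^ 3

/-- Solutions of `f(x, y) = 0` with `x ^ N = y ^ N = 1` for some positive integer `N`. -/
def solutions : Set (ℂ × ℂ) :=
  {p | f p.1 p.2 = 0 ∧ ∃ N : ℕ, 0 < N ∧ p.1 ^ N = 1 ∧ p.2 ^ N = 1}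

noncomputable def α : ℂ := zeta 3

noncomputable def β : ℂ := zeta 5

noncomputable def γ : ℂ := zeta 7

def S₀ : Set (ℂ × ℂ) := {(1, -1), (-1, 1)}

def S₁ : Set (ℂ × ℂ) :=
  {(α, α), (α ^ 2, α), (α, α ^ 2), (α ^ 2, α ^ 2),
   (α, -α), (-α, α), (α ^ 2, -α ^ 2), (-α ^ 2, α ^ 2)}

def S₂ : Set (ℂ × ℂ) :=
  {(β * α, β * α ^ 2), (β ^ 2 * α, β ^ 2 * α ^ 2),
   (β ^ 3 * α, β ^ 3 * α ^ 2), (β ^ 4 * α, β ^ 4 * α ^ 2),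
   (β * α ^ 2, β * α), (β ^ 2 * α ^ 2, β ^ 2 * α),
   (β ^ 3 * α ^ 2, β ^ 3 * α), (β ^ 4 * α ^ 2, β ^ 4 * α)}

def S₃ : Set (ℂ × ℂ) :=
  {(γ, -γ ^ 4), (γ ^ 2, -γ), (γ ^ 3, -γ ^ 5),
   (γ ^ 4, -γ ^ 2), (γ ^ 5, -γ ^ 6), (γ ^ 6, -γ ^ 3),
   (-γ, γ ^ 2), (-γ ^ 2, γ ^ 4), (-γ ^ 3, γ ^ 6),
   (-γ ^ 4, γ), (-γ ^ 5, γ ^ 3), (-γ ^ 6, γ ^ 5)}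

def S : Set (ℂ × ℂ) := S₀ ∪ S₁ ∪ S₂ ∪ S₃

/-- One representative of each pair of exponents `(a, b)`, `(b, a)` with `a ≠ b`. -/
def PHalf : Finset (ℕ × ℕ) :=
  {(0, 105), (14, 154), (15, 30), (28, 98), (35, 140), (45, 90), (56, 196),
   (60, 135), (70, 140), (70, 175), (75, 150), (112, 182), (120, 165), (180, 195)}

/-- The exponents: two diagonal pairs, and the pairs above together with the symmetric ones. -/
def P : Finset (ℕ × ℕ) :=
  {(70, 70), (140, 140)} ∪ PHalf ∪ PHalf.image Prod.swap

end Sharygin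

namespace Sharygin

/-! With `s = x + y` and `p = x * y`, the equation reads `s * (1 + p ^ 2) + (1 + p ^ 3) = 0`, so `p`
determines `s`, and hence the unordered pair. A second equation comes from Galois conjugation. For
odd `N`, squaring is a conjugation. For `N = 2 * m`, the exponent `m + 1` (`m` even) or `m + 2` (`m`
odd) sends `x, y` to `±x, ±y` or `±x ^ 2, ±y ^ 2`; if both signs are plus, `N` can be halved. In
most sign cases, eliminating `s` leaves a product of cyclotomic factors in `p`, each giving an
explicit family. The exception is `(-x ^ 2, -y ^ 2)`, which a second conjugation rules out. All
orders found divide 210, so comparison with `S` and `P` is a finite check on exponents. -/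

open Polynomial in
/-- Zeros of `f` in roots of unity are stable under the Galois action. -/
lemma f_pow_eq_zero {N k : ℕ} (hN : 0 < N) (hk : k.Coprime N) {x y : ℂ}
    (hx : x ^ N = 1) (hy : y ^ N = 1) (h : f x y = 0) : f (x ^ k) (y ^ k) = 0 := by
  have hω := Complex.isPrimitiveRoot_exp N hN.ne'
  set ω := Complex.exp (2 * Real.pi * Complex.I / N)
  have : NeZero N := ⟨hN.ne'⟩
  obtain ⟨a, -, rfl⟩ := hω.eq_pow_of_pow_eq_one hx
  obtain ⟨b, -, rfl⟩ := hω.eq_pow_of_pow_eq_one hy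
  -- Both coordinates are powers of one primitive root, so the equation says that `ω` is a root of
  -- an integer polynomial; `ω ^ k` has the same minimal polynomial.
  let Q : ℤ[X] := 1 + X ^ a + X ^ b + (X ^ a) ^ 2 * (X ^ b) ^ 3 + (X ^ a) ^ 3 * (X ^ b) ^ 2
    + (X ^ a) ^ 3 * (X ^ b) ^ 3
  have hQ : ∀ z : ℂ, aeval z Q = f (z ^ a) (z ^ b) := fun z => by simp [Q, f]
  have hdvd : minpoly ℤ ω ∣ Q :=
    minpoly.isIntegrallyClosed_dvd (hω.isIntegral hN) (by rw [hQ, h])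
  rw [hω.minpoly_eq_pow_coprime hk] at hdvd
  obtain ⟨R, hR⟩ := hdvd
  rw [← pow_mul, ← pow_mul, mul_comm a, mul_comm b, pow_mul, pow_mul, ← hQ, hR, map_mul,
    minpoly.aeval, zero_mul]

lemma f_comm (x y : ℂ) : f x y = f y x := by unfold f; ring

/-- An algebraic description of the thirty solutions. -/
def IsListed (x y : ℂ) : Prop :=
  (x ^ 6 = 1 ∧ y = -x) ∨ (x ^ 2 + x + 1 = 0 ∧ (y = x ∨ y = x ^ 2)) ∨
  (∃ u w : ℂ, u ^ 4 + u ^ 3 + u ^ 2 + u + 1 = 0 ∧ w ^ 2 + w + 1 = 0 ∧ x = u * w ∧ y = u * w ^ 2) ∨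
  (x ^ 6 + x ^ 5 + x ^ 4 + x ^ 3 + x ^ 2 + x + 1 = 0 ∧ y = -x ^ 4) ∨
  (y ^ 6 + y ^ 5 + y ^ 4 + y ^ 3 + y ^ 2 + y + 1 = 0 ∧ x = -y ^ 4)

/-! ### Solutions with a prescribed product `p = x * y` -/

/-- If `p ^ 2 = -1`, the equation reduces to `1 + p ^ 3 = 1 - p = 0`, a contradiction. This permits
division by `1 + p ^ 2` when solving for `s`. -/
lemma one_add_mul_sq_ne_zero {x y : ℂ} (h : f x y = 0) : 1 + (x * y) ^ 2 ≠ 0 := by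
  intro h2
  have h3 : x * y = 1 := by
    unfold f at h
    linear_combination (x + y + x * y) * h2 - h
  rw [h3] at h2
  norm_num at h2

lemma isListed_of_mul_pow_three_eq_neg_one {x y : ℂ} (h : f x y = 0) (hp : (x * y) ^ 3 = -1) :
    IsListed x y := by
  have hs : x + y = 0 := by
    refine (mul_eq_zero.mp ?_).resolve_right (one_add_mul_sq_ne_zero h)
    unfold f at h
    linear_combination h - hp
  have hy : y = -x := by linear_combination hs
  subst hy
  exact Or.inl ⟨by linear_combination -hp, rfl⟩

lemma isListed_of_mul_cyclotomic_three {x y : ℂ} (h : f x y = 0)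
    (hp : (x * y) ^ 2 + x * y + 1 = 0) : IsListed x y := by
  have hD := one_add_mul_sq_ne_zero h
  have h3 : (x * y) ^ 3 = 1 := by linear_combination (x * y - 1) * hp
  have hs : x + y = 2 * (x * y) ^ 2 := by
    refine mul_right_cancel₀ hD ?_
    unfold f at h
    linear_combination h - (1 + 2 * (x * y)) * h3 - 2 * hp
  -- Since `p ^ 4 = p`, the quadratic `t ^ 2 - s * t + p` is `(t - p ^ 2) ^ 2`.
  have hx : x = (x * y) ^ 2 := by
    have : (x - (x * y) ^ 2) ^ 2 = 0 := by
      linear_combination x * hs + (x * y) * h3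
    exact sub_eq_zero.mp (pow_eq_zero_iff two_ne_zero |>.mp this)
  have hy : y = x := by linear_combination hs - 2 * hx
  refine Or.inr (Or.inl ⟨?_, Or.inl hy⟩)
  linear_combination hp + hx + (x * y) * h3 + (x + (x * y) ^ 2) * hx

lemma isListed_of_mul_eq_one {x y : ℂ} (h : f x y = 0) (hp : x * y = 1) : IsListed x y := by
  have hs : x + y = -1 := by
    unfold f at h
    linear_combination h / 2 - ((x + y) * (1 + x * y) + 1 + x * y + (x * y) ^ 2) / 2 * hp
  have hx : x ^ 2 + x + 1 = 0 := by linear_combination x * hs - hp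
  exact Or.inr (Or.inl ⟨hx, Or.inr (by linear_combination hs - hx)⟩)

lemma isListed_of_mul_cyclotomic_five {x y : ℂ} (h : f x y = 0)
    (hp : (x * y) ^ 4 + (x * y) ^ 3 + (x * y) ^ 2 + x * y + 1 = 0) : IsListed x y := by
  have hD := one_add_mul_sq_ne_zero h
  have h5 : (x * y) ^ 5 = 1 := by linear_combination (x * y - 1) * hp
  have hs : x + y = -(x * y) ^ 3 := by
    refine mul_right_cancel₀ hD ?_
    unfold f at h
    linear_combination h + h5
  -- With `u = p ^ 3`, one has `u ^ 2 = p` and `s = -u`, so `t = u * w` turns the quadratic into `u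
  -- ^ 2 * (w ^ 2 + w + 1)`; the root is `w = x / u = x * p ^ 2`.
  refine Or.inr (Or.inr (Or.inl ⟨(x * y) ^ 3, x * (x * y) ^ 2, ?_, ?_, ?_, ?_⟩))
  · linear_combination hp + ((x * y) ^ 7 + (x * y) ^ 2 + (x * y) ^ 4 + x * y) * h5
  · linear_combination x * (x * y) ^ 4 * hs - (1 + x * (x * y) ^ 2) * h5
  · linear_combination -x * h5
  · linear_combination (1 - (x * y) ^ 7 * x) * hs + ((x * y) ^ 3 + x * ((x * y) ^ 5 + 1)) * h5

lemma isListed_of_mul_cyclotomic_fourteen {x y : ℂ} (h : f x y = 0)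
    (hp : (x * y) ^ 6 - (x * y) ^ 5 + (x * y) ^ 4 - (x * y) ^ 3 + (x * y) ^ 2 - x * y + 1 = 0) :
    IsListed x y := by
  have hD := one_add_mul_sq_ne_zero h
  have h7 : (x * y) ^ 7 = -1 := by linear_combination (x * y + 1) * hp
  have hs : x + y = (x * y) ^ 5 - (x * y) ^ 3 := by
    refine mul_right_cancel₀ hD ?_
    unfold f at h
    linear_combination h - h7
  -- The quadratic with roots `x, y` splits as `(t + p ^ 3) * (t - p ^ 5)`, because `p ^ 8 = -p`.
  have hx : (x + (x * y) ^ 3) * (x - (x * y) ^ 5) = 0 := by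
    linear_combination x * hs - x * y * h7
  clear h hD
  generalize x * y = p at *
  have hc : ∀ z : ℂ, z = -p ^ 3 → z ^ 6 + z ^ 5 + z ^ 4 + z ^ 3 + z ^ 2 + z + 1 = 0 ∧
      p ^ 5 = -z ^ 4 := by
    rintro z rfl
    constructor
    · linear_combination hp + (p ^ 11 - p ^ 8 + p ^ 5 - p ^ 4 - p ^ 2 + p) * h7
    · linear_combination p ^ 5 * h7
  rcases mul_eq_zero.mp hx with hx | hx
  · have h1 : y = p ^ 5 := by linear_combination hs - hx
    have h2 := hc x (by linear_combination hx)
    exact Or.inr (Or.inr (Or.inr (Or.inl ⟨h2.1, h1.trans h2.2⟩)))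
  · have h1 : x = p ^ 5 := by linear_combination hx
    have h2 := hc y (by linear_combination hs - hx)
    exact Or.inr (Or.inr (Or.inr (Or.inr ⟨h2.1, h1.trans h2.2⟩)))

/-! ### Elimination of `s` against a conjugate equation -/

lemma isListed_of_f_sq_sq {x y : ℂ} (h : f x y = 0) (h2 : f (x ^ 2) (y ^ 2) = 0) :
    IsListed x y := by
  have hE : (x * y - 1) ^ 2 * ((x * y) ^ 2 + x * y + 1) * ((x * y) ^ 2 - x * y + 1) *
      ((x * y) ^ 4 + (x * y) ^ 3 + (x * y) ^ 2 + x * y + 1) = 0 := by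
    unfold f at h h2
    linear_combination (1 + (x * y) ^ 2) ^ 2 / 2 * h2 -
      (1 + (x * y) ^ 4) * ((x + y) * (1 + (x * y) ^ 2) - (1 + (x * y) ^ 3)) / 2 * h
  rcases mul_eq_zero.mp hE with hE | hE
  · rcases mul_eq_zero.mp hE with hE | hE
    · rcases mul_eq_zero.mp hE with hE | hE
      · exact isListed_of_mul_eq_one h (sub_eq_zero.mp (pow_eq_zero_iff two_ne_zero |>.mp hE))
      · exact isListed_of_mul_cyclotomic_three h hE
    · exact isListed_of_mul_pow_three_eq_neg_one h (by linear_combination (x * y + 1) * hE)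
  · exact isListed_of_mul_cyclotomic_five h hE

lemma isListed_of_f_neg_sq_sq {x y : ℂ} (hx : x ≠ 0) (hy : y ≠ 0) (h : f x y = 0)
    (h2 : f (-x ^ 2) (y ^ 2) = 0) : IsListed x y := by
  have hE : 4 * (x * y) * ((x * y) + 1) ^ 4 * ((x * y) ^ 2 + x * y + 1) *
      ((x * y) ^ 2 - x * y + 1) ^ 3 *
      ((x * y) ^ 6 - (x * y) ^ 5 + (x * y) ^ 4 - (x * y) ^ 3 + (x * y) ^ 2 - x * y + 1) = 0 := by
    have hA : (x + y) ^ 2 * (1 + (x * y) ^ 2) ^ 2 = (1 + (x * y) ^ 3) ^ 2 := by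
      unfold f at h
      linear_combination ((x + y) * (1 + (x * y) ^ 2) - (1 + (x * y) ^ 3)) * h
    unfold f at h2
    -- Multiplying by the conjugate factor leaves only `(y ^ 2 - x ^ 2) ^ 2 = s ^ 2 * (s ^ 2 - 4 *
    -- p)`, which `hA` expresses through `p`.
    linear_combination (1 + (x * y) ^ 2) ^ 4 *
      (1 - (x * y) ^ 6 - (y ^ 2 - x ^ 2) * (1 + (x * y) ^ 4)) * h2 +
      (1 + (x * y) ^ 4) ^ 2 * ((x + y) ^ 2 * (1 + (x * y) ^ 2) ^ 2 + (1 + (x * y) ^ 3) ^ 2 -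
        4 * (x * y) * (1 + (x * y) ^ 2) ^ 2) * hA
  have hxy : 4 * (x * y) ≠ 0 := by simp [hx, hy]
  rcases mul_eq_zero.mp hE with hE | hE
  · rcases mul_eq_zero.mp hE with hE | hE
    · rcases mul_eq_zero.mp hE with hE | hE
      · have := (pow_eq_zero_iff four_ne_zero).mp ((mul_eq_zero.mp hE).resolve_left hxy)
        exact isListed_of_mul_pow_three_eq_neg_one h
          (by linear_combination ((x * y) ^ 2 - x * y + 1) * this)
      · exact isListed_of_mul_cyclotomic_three h hE
    · have := (pow_eq_zero_iff three_ne_zero).mp hE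
      exact isListed_of_mul_pow_three_eq_neg_one h (by linear_combination (x * y + 1) * this)
  · exact isListed_of_mul_cyclotomic_fourteen h hE

/-- Elimination leaves a palindromic octic in `p`; division by `p ^ 4` makes it a quartic in `p +
p⁻¹`. -/
lemma trace_eq_zero_of_f_neg_sq_neg_sq {x y : ℂ} (hx : x ≠ 0) (hy : y ≠ 0) (h : f x y = 0)
    (h2 : f (-x ^ 2) (-y ^ 2) = 0) {c : ℂ} (hc : c = x * y + (x * y)⁻¹) :
    c ^ 4 + c ^ 3 - 3 * c ^ 2 - 3 * c + 2 = 0 := by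
  have hp : x * y ≠ 0 := mul_ne_zero hx hy
  have hq : 2 * (x * y) * ((x * y) ^ 8 + (x * y) ^ 7 + (x * y) ^ 6 + 2 * (x * y) ^ 4 +
      (x * y) ^ 2 + x * y + 1) = 0 := by
    unfold f at h h2
    linear_combination (1 + (x * y) ^ 2) ^ 2 * h2 +
      (1 + (x * y) ^ 4) * ((x + y) * (1 + (x * y) ^ 2) - (1 + (x * y) ^ 3)) * h
  have hq := (mul_eq_zero.mp hq).resolve_left (by simp [hx, hy])
  generalize x * y = p at *
  subst hc
  have : (p + p⁻¹) ^ 4 + (p + p⁻¹) ^ 3 - 3 * (p + p⁻¹) ^ 2 - 3 * (p + p⁻¹) + 2 =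
      (p ^ 8 + p ^ 7 + p ^ 6 + 2 * p ^ 4 + p ^ 2 + p + 1) / p ^ 4 := by
    field_simp
    ring
  rw [this, hq, zero_div]

/-- The conjugation replaces `p` by `p ^ 2`, hence `c` by `c ^ 2 - 2`. The quartic at `c` and at `c
^ 2 - 2` are coprime polynomials in `c`, as an explicit Bézout identity shows. -/
lemma not_f_neg_sq_neg_sq_twice {x y : ℂ} (hx : x ≠ 0) (hy : y ≠ 0) (h : f x y = 0)
    (h2 : f (-x ^ 2) (-y ^ 2) = 0) (h4 : f (-(-x ^ 2) ^ 2) (-(-y ^ 2) ^ 2) = 0) : False := by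
  have hp : x * y ≠ 0 := mul_ne_zero hx hy
  obtain ⟨c, hc⟩ : ∃ c, c = x * y + (x * y)⁻¹ := ⟨_, rfl⟩
  have e1 := trace_eq_zero_of_f_neg_sq_neg_sq hx hy h h2 hc
  have e2 := trace_eq_zero_of_f_neg_sq_neg_sq (x := -x ^ 2) (y := -y ^ 2) (by simpa) (by simpa)
    h2 h4 (c := c ^ 2 - 2) (by rw [hc]; field_simp; ring)
  have : (1 : ℂ) = 0 := by
    linear_combination (11 / 8 - 5 / 8 * c - 17 / 8 * c ^ 2 - 7 / 8 * c ^ 3) * e2 +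
      (-9 / 4 - 17 / 8 * c + 21 / 4 * c ^ 2 + 33 / 8 * c ^ 3 - 23 / 4 * c ^ 4 - 33 / 8 * c ^ 5 +
        5 / 4 * c ^ 6 + 7 / 8 * c ^ 7) * e1
  exact one_ne_zero this

lemma isListed_of_f_neg_right {x y : ℂ} (hy : y ≠ 0) (h : f x y = 0)
    (h2 : f x (-y) = 0) : IsListed x y := by
  unfold f at h h2
  have h3 : 1 + x + x ^ 3 * y ^ 2 = 0 := by linear_combination (h + h2) / 2
  have h4 : 1 + x ^ 2 * y ^ 2 + x ^ 3 * y ^ 2 = 0 := by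
    refine (mul_eq_zero.mp ?_).resolve_left hy
    linear_combination (h - h2) / 2
  -- `h3` and `h4` are the even and odd parts in `y`; this combination eliminates `y`.
  have h5 : x ^ 2 + x + 1 = 0 := by linear_combination (1 + x) * h3 - x * h4
  have h6 : (y - x) * (y + x) = 0 := by
    linear_combination h3 - h5 - y ^ 2 * (x - 1) * h5
  rcases mul_eq_zero.mp h6 with h6 | h6
  · exact Or.inr (Or.inl ⟨h5, Or.inl (sub_eq_zero.mp h6)⟩)
  · exact Or.inl ⟨by linear_combination (x - 1) * (x ^ 3 + 1) * h5, by linear_combination h6⟩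

lemma isListed_of_f_neg_neg {x y : ℂ} (h : f x y = 0) (h2 : f (-x) (-y) = 0) :
    IsListed x y := by
  refine isListed_of_mul_pow_three_eq_neg_one h ?_
  unfold f at h h2
  linear_combination (h + h2) / 2

lemma IsListed.symm {x y : ℂ} (h : IsListed x y) : IsListed y x := by
  rcases h with ⟨h, rfl⟩ | ⟨h, rfl | rfl⟩ | ⟨u, w, hu, hw, rfl, rfl⟩ | h | h
  · exact Or.inl ⟨by linear_combination h, by ring⟩
  · exact Or.inr (Or.inl ⟨h, Or.inl rfl⟩)
  · exact Or.inr (Or.inl ⟨by linear_combination (x ^ 2 - x + 1) * h,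
      Or.inr (by linear_combination -(x ^ 2 - x) * h)⟩)
  · exact Or.inr (Or.inr (Or.inl ⟨u, w ^ 2, hu, by linear_combination (w ^ 2 - w + 1) * hw, rfl,
      by linear_combination -u * (w ^ 2 - w) * hw⟩))
  · exact Or.inr (Or.inr (Or.inr (Or.inr h)))
  · exact Or.inr (Or.inr (Or.inr (Or.inl h)))

/-! ### Choice of the conjugation by `N` modulo 4 -/

lemma isListed_of_pow_eq_one (N : ℕ) (hN : 0 < N) {x y : ℂ} (hx : x ^ N = 1) (hy : y ^ N = 1)
    (h : f x y = 0) : IsListed x y := by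
  induction N using Nat.strong_induction_on with
  | _ N ih =>
  have hx0 : x ≠ 0 := by rintro rfl; simp [hN.ne'] at hx
  have hy0 : y ≠ 0 := by rintro rfl; simp [hN.ne'] at hy
  rcases Nat.even_or_odd' N with ⟨m, rfl | rfl⟩
  · have sign : ∀ z : ℂ, z ^ (2 * m) = 1 → z ^ m = 1 ∨ z ^ m = -1 := fun z hz =>
      by simpa [pow_mul'] using hz
    by_cases hm : x ^ m = 1 ∧ y ^ m = 1
    · exact ih m (by omega) (by omega) hm.1 hm.2
    rcases Nat.even_or_odd m with he | ho
    · have hk : (m + 1).Coprime (2 * m) :=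
        Nat.Coprime.mul_right (Nat.coprime_two_right.mpr he.add_one) (by simp)
      have hg := f_pow_eq_zero hN hk hx hy h
      rw [pow_succ, pow_succ] at hg
      rcases sign x hx with h1 | h1 <;> rcases sign y hy with h2 | h2 <;>
        simp only [h1, h2, one_mul, neg_mul] at hg hm
      · simp at hm
      · exact isListed_of_f_neg_right hy0 h hg
      · rw [f_comm] at h hg
        exact (isListed_of_f_neg_right hx0 h hg).symm
      · exact isListed_of_f_neg_neg h hg
    · have hk : (m + 2).Coprime (2 * m) :=
        Nat.Coprime.mul_right (Nat.coprime_two_right.mpr (ho.add_even even_two))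
          (by simpa using Nat.coprime_two_left.mpr ho)
      have hg := f_pow_eq_zero hN hk hx hy h
      have hg2 := f_pow_eq_zero hN hk (x := x ^ (m + 2)) (y := y ^ (m + 2))
        (by rw [pow_right_comm, hx, one_pow]) (by rw [pow_right_comm, hy, one_pow]) hg
      simp only [pow_add _ m 2] at hg
      rw [pow_add x, pow_add y] at hg2
      rcases sign x hx with h1 | h1 <;> rcases sign y hy with h2 | h2 <;>
        simp only [h1, h2, one_mul, neg_mul] at hg hg2 hm
      · simp at hm
      · rw [f_comm] at h hg
        exact (isListed_of_f_neg_sq_sq hy0 hx0 h hg).symm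
      · exact isListed_of_f_neg_sq_sq hx0 hy0 h hg
      · have hs : ∀ z : ℂ, z ^ m = -1 → (-z ^ 2) ^ (m + 2) = -(-z ^ 2) ^ 2 := fun z hz => by
          rw [pow_add, ho.neg_pow, pow_right_comm, hz]
          ring
        rw [hs x h1, hs y h2] at hg2
        exact (not_f_neg_sq_neg_sq_twice hx0 hy0 h hg hg2).elim
  · exact isListed_of_f_sq_sq h (f_pow_eq_zero hN (Nat.coprime_two_left.mpr (by simp)) hx hy h)

lemma IsListed.f_eq_zero {x y : ℂ} (h : IsListed x y) : f x y = 0 := by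
  unfold f
  rcases h with ⟨h, rfl⟩ | ⟨h, rfl | rfl⟩ | ⟨u, w, hu, hw, rfl, rfl⟩ | ⟨h, rfl⟩ | ⟨h, rfl⟩
  · linear_combination -h
  · linear_combination (y ^ 4 + y ^ 3 - 2 * y ^ 2 + y + 1) * h
  · linear_combination (1 + x ^ 7) * h
  · linear_combination (u + u ^ 5 * w ^ 6 - u ^ 5 * (w ^ 3 + 1) * (w - 1) +
      u ^ 6 * (w ^ 6 + w ^ 3 + 1) * (w - 1)) * hw + (1 - u) ^ 2 * hu
  · linear_combination (x ^ 4 - (1 + x) * (x ^ 7 + 1)) * (x - 1) * h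
  · linear_combination (y ^ 4 - (1 + y) * (y ^ 7 + 1)) * (y - 1) * h

/-! ### Passage to exponents modulo 210 -/

lemma isPrimitiveRoot_zeta {N : ℕ} (hN : N ≠ 0) : IsPrimitiveRoot (zeta N) N :=
  Complex.isPrimitiveRoot_exp N hN

lemma zeta_pow_of_mul_eq {n d N : ℕ} (hd : d ≠ 0) (h : d * n = N) : zeta N ^ d = zeta n := by
  subst h
  have hd' : (d : ℂ) ≠ 0 := by exact_mod_cast hd
  rw [zeta, zeta, ← Complex.exp_nat_mul, Nat.cast_mul]
  congr 1
  rw [mul_div_assoc', mul_div_mul_left _ _ hd']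

lemma zeta_pow_half : zeta 210 ^ 105 = -1 := by
  rw [zeta_pow_of_mul_eq (n := 2) (by norm_num) (by norm_num)]
  exact (isPrimitiveRoot_zeta two_ne_zero).eq_neg_one_of_two_right

lemma zeta_pow_mod (a : ℕ) : zeta 210 ^ (a % 210) = zeta 210 ^ a :=
  (pow_eq_pow_mod a (isPrimitiveRoot_zeta (by norm_num)).pow_eq_one).symm

lemma exists_eq_zeta_pow {n d : ℕ} (hn : n ≠ 0) (hd : d ≠ 0) (h : d * n = 210) {x : ℂ}
    (hx : x ^ n = 1) : ∃ i < n, x = zeta 210 ^ (d * i) := by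
  have : NeZero n := ⟨hn⟩
  obtain ⟨i, hi, rfl⟩ := (isPrimitiveRoot_zeta hn).eq_pow_of_pow_eq_one hx
  exact ⟨i, hi, by rw [pow_mul, zeta_pow_of_mul_eq hd h]⟩

/-- The pair of powers of `zeta 210` with the given exponents. -/
noncomputable def zetaPair (ab : ℕ × ℕ) : ℂ × ℂ := (zeta 210 ^ ab.1, zeta 210 ^ ab.2)

lemma zetaPair_mem {x y : ℂ} {a b : ℕ} (hx : x = zeta 210 ^ a) (hy : y = zeta 210 ^ b)
    (h : (a % 210, b % 210) ∈ P) : (x, y) ∈ zetaPair '' P :=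
  ⟨_, h, by rw [zetaPair, zeta_pow_mod, zeta_pow_mod, hx, hy]⟩

lemma neg_zeta_pow (a : ℕ) : -zeta 210 ^ a = zeta 210 ^ (105 + a) := by
  rw [pow_add, zeta_pow_half, neg_one_mul]

lemma exists_of_cyclotomic_three {x : ℂ} (h : x ^ 2 + x + 1 = 0) :
    ∃ i ∈ Finset.Icc 1 2, x = zeta 210 ^ (70 * i) := by
  obtain ⟨i, hi, rfl⟩ := exists_eq_zeta_pow (n := 3) (d := 70) (x := x) (by norm_num) (by norm_num)
    rfl (by linear_combination (x - 1) * h)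
  refine ⟨i, Finset.mem_Icc.mpr ⟨Nat.one_le_iff_ne_zero.mpr ?_, by omega⟩, rfl⟩
  rintro rfl
  norm_num at h

lemma exists_of_cyclotomic_five {x : ℂ} (h : x ^ 4 + x ^ 3 + x ^ 2 + x + 1 = 0) :
    ∃ i ∈ Finset.Icc 1 4, x = zeta 210 ^ (42 * i) := by
  obtain ⟨i, hi, rfl⟩ := exists_eq_zeta_pow (n := 5) (d := 42) (x := x) (by norm_num) (by norm_num)
    rfl (by linear_combination (x - 1) * h)
  refine ⟨i, Finset.mem_Icc.mpr ⟨Nat.one_le_iff_ne_zero.mpr ?_, by omega⟩, rfl⟩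
  rintro rfl
  norm_num at h

lemma exists_of_cyclotomic_seven {x : ℂ}
    (h : x ^ 6 + x ^ 5 + x ^ 4 + x ^ 3 + x ^ 2 + x + 1 = 0) :
    ∃ i ∈ Finset.Icc 1 6, x = zeta 210 ^ (30 * i) := by
  obtain ⟨i, hi, rfl⟩ := exists_eq_zeta_pow (n := 7) (d := 30) (x := x) (by norm_num) (by norm_num)
    rfl (by linear_combination (x - 1) * h)
  refine ⟨i, Finset.mem_Icc.mpr ⟨Nat.one_le_iff_ne_zero.mpr ?_, by omega⟩, rfl⟩
  rintro rfl
  norm_num at h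

lemma IsListed.mem_image {x y : ℂ} (h : IsListed x y) : (x, y) ∈ zetaPair '' P := by
  rcases h with ⟨h, rfl⟩ | ⟨h, rfl | rfl⟩ | ⟨u, w, hu, hw, rfl, rfl⟩ | ⟨h, rfl⟩ | ⟨h, rfl⟩
  · obtain ⟨i, hi, rfl⟩ := exists_eq_zeta_pow (n := 6) (d := 35) (by norm_num) (by norm_num) rfl h
    refine zetaPair_mem rfl (neg_zeta_pow _) ?_
    clear h; revert i; decide
  · obtain ⟨i, hi, rfl⟩ := exists_of_cyclotomic_three h
    refine zetaPair_mem rfl rfl ?_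
    clear h; revert i; decide
  · obtain ⟨i, hi, rfl⟩ := exists_of_cyclotomic_three h
    refine zetaPair_mem rfl (pow_mul _ _ _).symm ?_
    clear h; revert i; decide
  · obtain ⟨i, hi, rfl⟩ := exists_of_cyclotomic_five hu
    obtain ⟨j, hj, rfl⟩ := exists_of_cyclotomic_three hw
    refine zetaPair_mem (pow_add _ _ _).symm (by rw [← pow_mul, ← pow_add]) ?_
    clear hu hw; revert i j; decide
  · obtain ⟨i, hi, rfl⟩ := exists_of_cyclotomic_seven h
    refine zetaPair_mem rfl (by rw [← pow_mul, neg_zeta_pow]) ?_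
    clear h; revert i; decide
  · obtain ⟨i, hi, rfl⟩ := exists_of_cyclotomic_seven h
    refine zetaPair_mem (by rw [← pow_mul, neg_zeta_pow]) rfl ?_
    clear h; revert i; decide

lemma zeta_pow_sub_one_ne_zero {a : ℕ} (ha : a % 210 ≠ 0) : zeta 210 ^ a - 1 ≠ 0 := by
  rw [sub_ne_zero, Ne, (isPrimitiveRoot_zeta (by norm_num)).pow_eq_one_iff_dvd]
  omega

lemma zeta_pow_eq {a b : ℕ} (h : a % 210 = b % 210) : zeta 210 ^ a = zeta 210 ^ b := by
  rw [← zeta_pow_mod, h, zeta_pow_mod]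

lemma cyclotomic_three_zeta {a : ℕ} (h : a * 3 % 210 = 0) (h0 : a % 210 ≠ 0) :
    (zeta 210 ^ a) ^ 2 + zeta 210 ^ a + 1 = 0 := by
  refine (mul_eq_zero.mp ?_).resolve_left (zeta_pow_sub_one_ne_zero h0)
  have : (zeta 210 ^ a) ^ 3 = 1 := by rw [← pow_mul, zeta_pow_eq (b := 0) h, pow_zero]
  linear_combination this

lemma cyclotomic_five_zeta {a : ℕ} (h : a * 5 % 210 = 0) (h0 : a % 210 ≠ 0) :
    (zeta 210 ^ a) ^ 4 + (zeta 210 ^ a) ^ 3 + (zeta 210 ^ a) ^ 2 + zeta 210 ^ a + 1 = 0 := by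
  refine (mul_eq_zero.mp ?_).resolve_left (zeta_pow_sub_one_ne_zero h0)
  have : (zeta 210 ^ a) ^ 5 = 1 := by rw [← pow_mul, zeta_pow_eq (b := 0) h, pow_zero]
  linear_combination this

lemma cyclotomic_seven_zeta {a : ℕ} (h : a * 7 % 210 = 0) (h0 : a % 210 ≠ 0) :
    (zeta 210 ^ a) ^ 6 + (zeta 210 ^ a) ^ 5 + (zeta 210 ^ a) ^ 4 + (zeta 210 ^ a) ^ 3 +
      (zeta 210 ^ a) ^ 2 + zeta 210 ^ a + 1 = 0 := by
  refine (mul_eq_zero.mp ?_).resolve_left (zeta_pow_sub_one_ne_zero h0)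
  have : (zeta 210 ^ a) ^ 7 = 1 := by rw [← pow_mul, zeta_pow_eq (b := 0) h, pow_zero]
  linear_combination this

/-- The five families of `IsListed`, translated into congruences on exponents. -/
lemma exponent_cases : ∀ ab ∈ P,
    (ab.1 * 6 % 210 = 0 ∧ ab.2 % 210 = (105 + ab.1) % 210) ∨
    (ab.1 * 3 % 210 = 0 ∧ ab.1 % 210 ≠ 0 ∧
      (ab.2 % 210 = ab.1 % 210 ∨ ab.2 % 210 = ab.1 * 2 % 210)) ∨
    (∃ i ∈ Finset.Icc 1 4, ∃ j ∈ Finset.Icc 1 2,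
      ab.1 % 210 = (42 * i + 70 * j) % 210 ∧ ab.2 % 210 = (42 * i + 70 * j * 2) % 210) ∨
    (ab.1 * 7 % 210 = 0 ∧ ab.1 % 210 ≠ 0 ∧ ab.2 % 210 = (105 + ab.1 * 4) % 210) ∨
    (ab.2 * 7 % 210 = 0 ∧ ab.2 % 210 ≠ 0 ∧ ab.1 % 210 = (105 + ab.2 * 4) % 210) := by
  decide

lemma isListed_zeta_pow {ab : ℕ × ℕ} (hab : ab ∈ P) :
    IsListed (zeta 210 ^ ab.1) (zeta 210 ^ ab.2) := by
  rcases exponent_cases ab hab with ⟨h, h2⟩ | ⟨h, h0, h2 | h2⟩ | ⟨i, hi, j, hj, h1, h2⟩ |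
    ⟨h, h0, h2⟩ | ⟨h, h0, h2⟩
  · refine Or.inl ⟨by rw [← pow_mul, zeta_pow_eq (b := 0) h, pow_zero], ?_⟩
    rw [neg_zeta_pow, zeta_pow_eq h2]
  · exact Or.inr (Or.inl ⟨cyclotomic_three_zeta h h0, Or.inl (zeta_pow_eq h2)⟩)
  · refine Or.inr (Or.inl ⟨cyclotomic_three_zeta h h0, Or.inr ?_⟩)
    rw [← pow_mul, zeta_pow_eq h2]
  · rw [Finset.mem_Icc] at hi hj
    refine Or.inr (Or.inr (Or.inl ⟨zeta 210 ^ (42 * i), zeta 210 ^ (70 * j),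
      cyclotomic_five_zeta (by omega) (by omega), cyclotomic_three_zeta (by omega) (by omega),
      ?_, ?_⟩))
    · rw [← pow_add, zeta_pow_eq h1]
    · rw [← pow_mul, ← pow_add, zeta_pow_eq h2]
  · refine Or.inr (Or.inr (Or.inr (Or.inl ⟨cyclotomic_seven_zeta h h0, ?_⟩)))
    rw [← pow_mul, neg_zeta_pow, zeta_pow_eq h2]
  · refine Or.inr (Or.inr (Or.inr (Or.inr ⟨cyclotomic_seven_zeta h h0, ?_⟩)))
    rw [← pow_mul, neg_zeta_pow, zeta_pow_eq h2]

lemma solutions_eq_image : solutions = zetaPair '' P := by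
  ext ⟨x, y⟩
  constructor
  · rintro ⟨h, N, hN, hx, hy⟩
    exact (isListed_of_pow_eq_one N hN hx hy h).mem_image
  · rintro ⟨ab, hab, h⟩
    rw [← h]
    have h1 := (isPrimitiveRoot_zeta (N := 210) (by norm_num)).pow_eq_one
    refine ⟨(isListed_zeta_pow hab).f_eq_zero, 210, by norm_num, ?_, ?_⟩ <;>
    · simp only [zetaPair]
      rw [pow_right_comm, h1, one_pow]

/-- Unreduced exponents of the elements of `S`, in the order of its definition. -/
def exponents : Finset (ℕ × ℕ) :=
  {(0, 105), (105, 0)} ∪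
  {(70, 70), (70 * 2, 70), (70, 70 * 2), (70 * 2, 70 * 2),
   (70, 105 + 70), (105 + 70, 70), (70 * 2, 105 + 70 * 2), (105 + 70 * 2, 70 * 2)} ∪
  {(42 + 70, 42 + 70 * 2), (42 * 2 + 70, 42 * 2 + 70 * 2),
   (42 * 3 + 70, 42 * 3 + 70 * 2), (42 * 4 + 70, 42 * 4 + 70 * 2),
   (42 + 70 * 2, 42 + 70), (42 * 2 + 70 * 2, 42 * 2 + 70),
   (42 * 3 + 70 * 2, 42 * 3 + 70), (42 * 4 + 70 * 2, 42 * 4 + 70)} ∪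
  {(30, 105 + 30 * 4), (30 * 2, 105 + 30), (30 * 3, 105 + 30 * 5),
   (30 * 4, 105 + 30 * 2), (30 * 5, 105 + 30 * 6), (30 * 6, 105 + 30 * 3),
   (105 + 30, 30 * 2), (105 + 30 * 2, 30 * 4), (105 + 30 * 3, 30 * 6),
   (105 + 30 * 4, 30), (105 + 30 * 5, 30 * 3), (105 + 30 * 6, 30 * 5)}

lemma S_eq_image_exponents : S = zetaPair '' exponents := by
  have hα : zeta 210 ^ 70 = α := zeta_pow_of_mul_eq (by norm_num) (by norm_num)
  have hβ : zeta 210 ^ 42 = β := zeta_pow_of_mul_eq (by norm_num) (by norm_num)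
  have hγ : zeta 210 ^ 30 = γ := zeta_pow_of_mul_eq (by norm_num) (by norm_num)
  -- Unreduced exponents split literally: 105 contributes the sign, and 70, 42, 30 contribute `α`,
  -- `β`, `γ`.
  simp only [S, S₀, S₁, S₂, S₃, exponents, Finset.coe_union, Finset.coe_insert,
    Finset.coe_singleton, Set.image_union, Set.image_insert_eq, Set.image_singleton, zetaPair,
    pow_add, pow_mul, pow_zero, hα, hβ, hγ, zeta_pow_half, neg_one_mul]

lemma image_exponents_mod : exponents.image (fun ab => (ab.1 % 210, ab.2 % 210)) = P := by
  decide

lemma S_eq_image : S = zetaPair '' P := by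
  rw [S_eq_image_exponents, ← image_exponents_mod, Finset.coe_image, Set.image_image]
  simp only [zetaPair, zeta_pow_mod]
  rfl

lemma zetaPair_injOn : Set.InjOn zetaPair P := by
  have hlt : ∀ ab ∈ P, ab.1 < 210 ∧ ab.2 < 210 := by decide
  have h1 := isPrimitiveRoot_zeta (N := 210) (by norm_num)
  rintro ⟨a, b⟩ hab ⟨c, d⟩ hcd h
  obtain ⟨h2, h3⟩ := Prod.mk.inj h
  obtain ⟨ha, hb⟩ := hlt _ hab
  obtain ⟨hc, hd⟩ := hlt _ hcd
  exact Prod.ext (h1.pow_inj ha hc h2) (h1.pow_inj hb hd h3)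

lemma card_P : P.card = 30 := by decide

end Sharygin

theorem mainTheorem1 :
    Sharygin.solutions = Sharygin.S ∧
    Sharygin.S.ncard = 30 ∧
    Sharygin.P.card = 30 ∧
    Sharygin.solutions =
      {p : ℂ × ℂ | ∃ ab ∈ Sharygin.P,
        p = (Sharygin.zeta 210 ^ ab.1, Sharygin.zeta 210 ^ ab.2)} := by
  refine ⟨Sharygin.solutions_eq_image.trans Sharygin.S_eq_image.symm, ?_, Sharygin.card_P, ?_⟩
  · rw [Sharygin.S_eq_image, Sharygin.zetaPair_injOn.ncard_image,
      Set.ncard_coe_finset, Sharygin.card_P]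
  · rw [Sharygin.solutions_eq_image]
    ext p
    simp only [Set.mem_image, Set.mem_ofPred_eq, SetLike.mem_coe, Sharygin.zetaPair, eq_comm]
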